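/- \textbf{Setting.} An agent chooses effort $a\in A=[\underline a,\bar a]$, $0\le\underline a\le\bar a$, and the state $\omega$ lies in $\Omega=[\underline\omega,\bar\omega]$, $0<\underline\omega\le\bar\omega$, with a common prior $p$ that is a Borel probability measure on $\Omega$. Output is $y(\omega,a)=\omega a^{\kappa}$ with $\kappa\in(0,1)$; the agent receives the wage $\delta y$ and the principal receives $(1-\delta)y$, where $\delta\in(0,1)$. Both have CRRA utilities of money $u(x)=\frac{x^{1-\gamma}}{1-\gamma}$ (agent) and $v(x)=\frac{x^{1-\rho}}{1-\rho}$ (principal), with $\gamma,\rho\ge 0$, $\gamma\ne1$, $\rho\ne1$, and the cost of effort is $a$. So the payoffs of the agent and of the principal are $$U(\omega,a)=\frac{(\delta\omega a^{\kappa})^{1-\gamma}}{1-\gamma}-a,\qquad V(\omega,a)=\frac{((1-\delta)\omega a^{\kappa})^{1-\rho}}{1-\rho},$$ where $U(\omega,0)=-\infty$ if $\gamma>1$. Assume that for every $\omega\in\Omega$ there is $a\in A$, $a>0$, with $U_a(\omega,a)=0$ (the agent's problem under a known state has a stationary solution in $A$). Before the state is realized, the principal commits to an information structure, that is, a Markov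 kernel from $\Omega$ to some measurable space of messages. After a message $m$ the agent chooses an effort in $A$ that maximizes $\mathbb E(U(\omega,a)\mid m)$. The principal's payoff from an information structure is the resulting expectation of $V(\omega,a)$. Full disclosure is the information structure whose message is the state itself. It is optimal if no information structure gives the principal a higher payoff, and suboptimal if some information structure gives the principal a strictly higher payoff. \textbf{Claim.} The principal's payoff from every information structure exists, is finite and is uniquely determined. Moreover: \begin{enumerate} \item If $\rho\le\gamma<1$ or $\rho\ge\gamma>1$, then full disclosure is optimal. \item If $\rho<1<\gamma$ or $\gamma<1<\rho$, and the support of $p$ contains at least two states, then full disclosure is suboptimal. \end{enumerate} -/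

import Mathlib

open MeasureTheory ProbabilityTheory

universe u

noncomputable section

namespace Persuasion

/-! ### The persuasion problem

States and actions are real numbers. The prior `p` is a probability measure on `ℝ` (concentrated on
the state space), `A` is the set of actions available to the receiver, `U ω a` and `V ω a` are the
utilities of the receiver and of the sender. An information structure is a Markov kernel `K` from
states to a measurable space `M` of messages. -/

/-- `a` maximizes the receiver's expected utility over `A` under the belief `μ`. -/
def IsBestResponse (A : Set ℝ) (U : ℝ → ℝ → ℝ) (μ : Measure ℝ) (a : ℝ) : Prop :=
  a ∈ A ∧ ∀ b ∈ A, ∫ ω, U ω b ∂μ ≤ ∫ ω, U ω a ∂μ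

/-- `σ` is a measurable action plan of the receiver that is optimal after almost every message,
where `posterior K p m` is the Bayesian posterior on states given the message `m` and
`K ∘ₘ p` is the distribution of messages. -/
structure IsOptimalPlan {M : Type*} [MeasurableSpace M] (A : Set ℝ) (U : ℝ → ℝ → ℝ)
    (p : Measure ℝ) [IsFiniteMeasure p] (K : Kernel ℝ M) [IsMarkovKernel K] (σ : M → ℝ) :
    Prop where
  measurable : Measurable σ
  optimal : ∀ᵐ m ∂(Measure.bind p K), IsBestResponse A U (posterior K p m) (σ m)

/-- `v` is the sender's (finite) expected utility from the information structure `K`, when the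
receiver best responds to every message. The measure `p ⊗ₘ K` is the joint law of the state and
the message. -/
def IsSenderPayoff {M : Type*} [MeasurableSpace M] (A : Set ℝ) (U V : ℝ → ℝ → ℝ)
    (p : Measure ℝ) [IsFiniteMeasure p] (K : Kernel ℝ M) [IsMarkovKernel K] (v : ℝ) : Prop :=
  ∃ σ : M → ℝ, IsOptimalPlan A U p K σ ∧
    Integrable (fun x : ℝ × M => V x.1 (σ x.2)) (p.compProd K) ∧
    v = ∫ x : ℝ × M, V x.1 (σ x.2) ∂(p.compProd K)

/-- Full disclosure: the message is the state itself. -/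
abbrev fullDisclosure : Kernel ℝ ℝ := Kernel.id

/-- Every information structure gives the sender one and only one expected utility. -/
def IsWellPosed (A : Set ℝ) (U V : ℝ → ℝ → ℝ) (p : Measure ℝ) [IsFiniteMeasure p] : Prop :=
  ∀ (M : Type u) [MeasurableSpace M] (K : Kernel ℝ M) [IsMarkovKernel K],
    ∃! v : ℝ, IsSenderPayoff A U V p K v

/-- No information structure gives the sender more than full disclosure. -/
def FullDisclosureOptimal (A : Set ℝ) (U V : ℝ → ℝ → ℝ) (p : Measure ℝ) [IsFiniteMeasure p] :
    Prop :=
  ∃ v₀ : ℝ, IsSenderPayoff A U V p fullDisclosure v₀ ∧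
    ∀ (M : Type u) [MeasurableSpace M] (K : Kernel ℝ M) [IsMarkovKernel K] (v : ℝ),
      IsSenderPayoff A U V p K v → v ≤ v₀

/-- Some information structure gives the sender strictly more than full disclosure. -/
def FullDisclosureSuboptimal (A : Set ℝ) (U V : ℝ → ℝ → ℝ) (p : Measure ℝ)
    [IsFiniteMeasure p] : Prop :=
  ∃ v₀ : ℝ, IsSenderPayoff A U V p fullDisclosure v₀ ∧
    ∃ (M : Type u) (_ : MeasurableSpace M) (K : Kernel ℝ M) (_ : IsMarkovKernel K) (v : ℝ),
      IsSenderPayoff A U V p K v ∧ v₀ < v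

/-! ### The principal-agent model with constant relative risk aversion -/

/-- CRRA utility of money with coefficient `γ ≠ 1`. -/
def crra (γ x : ℝ) : ℝ := x ^ (1 - γ) / (1 - γ)

/-- Output produced by effort `a` in state `ω`. -/
def output (κ ω a : ℝ) : ℝ := ω * a ^ κ

/-- Linear wage: the agent receives the share `δ` of the output. -/
def wage (δ y : ℝ) : ℝ := δ * y

/-- The agent's (receiver's) utility: utility of the wage minus the cost of effort. -/
def agentUtility (κ δ γ ω a : ℝ) : ℝ := crra γ (wage δ (output κ ω a)) - a

/-- The principal's (sender's) utility: utility of the output net of the wage. -/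
def principalUtility (κ δ ρ ω a : ℝ) : ℝ := crra ρ (output κ ω a - wage δ (output κ ω a))

/-- The effort levels in `[aLo, aHi]` at which the agent's utility is finite. If `γ > 1`, zero
effort yields zero consumption and utility `-∞`, so the agent never chooses it and it is left
out. -/
def effortSet (γ aLo aHi : ℝ) : Set ℝ := {a | a ∈ Set.Icc aLo aHi ∧ (1 < γ → a ≠ 0)}

end Persuasion

end

/-!
After a message, the agent's best response depends on his posterior `μ` only through the mean of
`X = ω ^ (1 - γ)`, and a belief `μ` is worth `c * (E[X ^ t] * (E X) ^ s)` to the principal, where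
`t = (1 - ρ) / (1 - γ)`, `s = κ * (1 - ρ) / (1 - κ * (1 - γ))` and `c` has the sign of `1 - ρ`. If
the state is revealed instead, the belief becomes worth `c * E[X ^ (t + s)]`. Full disclosure is
therefore optimal once revealing is at least as good as concealing at every belief, and suboptimal
once concealing is strictly better at the prior. Jensen's inequality compares the two moments:
for `c > 0`, revealing wins if `0 ≤ s`, `0 ≤ t` and `1 ≤ t + s`, and concealing if `t + s < 0 < s`;
for `c < 0`, revealing wins if `s ≤ 0 ≤ t + s` and `1 ≤ t`, and concealing if `t, s < 0`.
-/

namespace Persuasion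

section PowerInequalities

lemma one_add_mul_sub_lt_rpow_of_neg {x θ : ℝ} (hx : 0 < x) (hx1 : x ≠ 1) (hθ : θ < 0) :
    1 + θ * (x - 1) < x ^ θ :=
  calc 1 + θ * (x - 1) < Real.log x * θ + 1 := by
        nlinarith [Real.log_lt_sub_one_of_pos hx hx1]
    _ ≤ x ^ θ := (Real.add_one_le_exp _).trans_eq (Real.rpow_def_of_pos hx θ).symm

lemma strictConvexOn_rpow_of_neg {q : ℝ} (hq : q < 0) :
    StrictConvexOn ℝ (Set.Ioi 0) fun x : ℝ => x ^ q := by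
  refine ⟨convex_Ioi 0, fun x hx y hy hxy a b ha hb hab => ?_⟩
  have hlog := strictConcaveOn_log_Ioi.2 hx hy hxy ha hb hab
  have hexp := convexOn_exp.2 (Set.mem_univ (Real.log x * q)) (Set.mem_univ (Real.log y * q))
    ha.le hb.le hab
  simp only [smul_eq_mul] at hlog hexp ⊢
  have hz : 0 < a * x + b * y := add_pos (mul_pos ha hx) (mul_pos hb hy)
  rw [Real.rpow_def_of_pos hx, Real.rpow_def_of_pos hy, Real.rpow_def_of_pos hz]
  exact (Real.exp_lt_exp.2 (by nlinarith)).trans_le hexp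

lemma rpow_div_sub_self_lt {x θ : ℝ} (hx : 0 ≤ x) (hx0 : θ < 0 → x ≠ 0) (hx1 : x ≠ 1)
    (hθ0 : θ ≠ 0) (hθ1 : θ < 1) : x ^ θ / θ - x < 1 / θ - 1 := by
  rw [sub_lt_iff_lt_add]
  have hline : 1 / θ - 1 + x = (1 + θ * (x - 1)) / θ := by field_simp; ring
  rw [hline]
  rcases hθ0.lt_or_gt with hθ | hθ
  · exact div_lt_div_of_neg_of_lt hθ
      (one_add_mul_sub_lt_rpow_of_neg (hx.lt_of_ne' (hx0 hθ)) hx1 hθ)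
  · have h := rpow_one_add_lt_one_add_mul_self (s := x - 1) (by linarith) (sub_ne_zero.2 hx1)
      hθ hθ1
    rw [add_sub_cancel] at h
    gcongr

lemma mul_rpow_div_sub_lt {c θ a b : ℝ} (hθ0 : θ ≠ 0) (hθ1 : θ < 1) (ha : 0 < a)
    (hca : c * a ^ θ = a) (hb : 0 ≤ b) (hb0 : θ < 0 → b ≠ 0) (hne : b ≠ a) :
    c * (b ^ θ / θ) - b < c * (a ^ θ / θ) - a := by
  obtain ⟨x, rfl⟩ : ∃ x, b = a * x := ⟨b / a, (mul_div_cancel₀ b ha.ne').symm⟩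
  have hx : 0 ≤ x := nonneg_of_mul_nonneg_right hb ha
  have hlt := rpow_div_sub_self_lt hx (fun h => right_ne_zero_of_mul (hb0 h))
    (fun h => hne (by rw [h, mul_one])) hθ0 hθ1
  calc c * ((a * x) ^ θ / θ) - a * x = c * a ^ θ * (x ^ θ / θ) - a * x := by
        rw [Real.mul_rpow ha.le hx]; ring
    _ = a * (x ^ θ / θ - x) := by rw [hca]; ring
    _ < a * (1 / θ - 1) := by gcongr
    _ = c * a ^ θ * (1 / θ) - a := by rw [hca]; ring
    _ = c * (a ^ θ / θ) - a := by ring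

lemma rpow_mem_uIcc {x lo hi : ℝ} (hlo : 0 < lo) (hx : x ∈ Set.Icc lo hi) (q : ℝ) :
    x ^ q ∈ Set.uIcc (lo ^ q) (hi ^ q) := by
  have hx₀ : 0 < x := hlo.trans_le hx.1
  rcases le_total 0 q with hq | hq
  · exact Set.mem_uIcc_of_le (Real.rpow_le_rpow hlo.le hx.1 hq) (Real.rpow_le_rpow hx₀.le hx.2 hq)
  · exact Set.mem_uIcc_of_ge (Real.rpow_le_rpow_of_nonpos hx₀ hx.2 hq)
      (Real.rpow_le_rpow_of_nonpos hlo hx.1 hq)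

lemma pos_of_mem_uIcc_rpow {x lo hi q : ℝ} (hlo : 0 < lo) (hhi : 0 < hi)
    (hx : x ∈ Set.uIcc (lo ^ q) (hi ^ q)) : 0 < x :=
  (lt_min (Real.rpow_pos_of_pos hlo q) (Real.rpow_pos_of_pos hhi q)).trans_le hx.1

end PowerInequalities

section MomentInequalities

lemma integrable_rpow_of_mem_Icc {Ω : Type*} [MeasurableSpace Ω] {μ : Measure Ω}
    [IsFiniteMeasure μ] {f : Ω → ℝ} {lo hi : ℝ} (hfm : AEMeasurable f μ) (hlo : 0 < lo)
    (hf : ∀ᵐ ω ∂μ, f ω ∈ Set.Icc lo hi) (q : ℝ) : Integrable (fun ω => f ω ^ q) μ :=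
  Integrable.of_mem_Icc _ _ (hfm.pow_const q) (hf.mono fun _ hω => rpow_mem_uIcc hlo hω q)

variable {Ω : Type*} [MeasurableSpace Ω] {μ : Measure Ω} [IsProbabilityMeasure μ] {f : Ω → ℝ}
  {lo hi q t s : ℝ}

lemma integral_rpow_le_rpow_integral (hf₀ : 0 ≤ᵐ[μ] f) (hf : Integrable f μ) (hq₀ : 0 ≤ q)
    (hq₁ : q ≤ 1) : ∫ ω, f ω ^ q ∂μ ≤ (∫ ω, f ω ∂μ) ^ q := by
  have hfq : Integrable (fun ω => f ω ^ q) μ := by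
    refine ((integrable_const 1).add hf).mono'
      (hf.aestronglyMeasurable.aemeasurable.pow_const q).aestronglyMeasurable ?_
    filter_upwards [hf₀] with ω hω
    rw [Real.norm_of_nonneg (Real.rpow_nonneg hω q)]
    have h := rpow_one_add_le_one_add_mul_self (s := f ω - 1) (p := q)
      (by linarith [show 0 ≤ f ω from hω]) hq₀ hq₁
    rw [add_sub_cancel] at h
    simp only [Pi.add_apply]
    nlinarith [show 0 ≤ f ω from hω]
  exact (Real.concaveOn_rpow hq₀ hq₁).le_map_integral
    (Real.continuous_rpow_const hq₀).continuousOn isClosed_Ici hf₀ hf hfq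

lemma integral_rpow_mul_rpow_integral_le (hf₀ : 0 ≤ᵐ[μ] f) (ht : 0 ≤ t) (hs : 0 ≤ s)
    (hts : 1 ≤ t + s) (hf : Integrable (fun ω => f ω ^ (t + s)) μ) :
    (∫ ω, f ω ^ t ∂μ) * (∫ ω, f ω ∂μ) ^ s ≤ ∫ ω, f ω ^ (t + s) ∂μ := by
  have hr : 0 < t + s := one_pos.trans_le hts
  have hI : 0 ≤ ∫ ω, f ω ^ (t + s) ∂μ :=
    integral_nonneg_of_ae (hf₀.mono fun ω hω => Real.rpow_nonneg hω _)
  -- Jensen for the concave powers `q / (t + s) ≤ 1` of `f ^ (t + s)`.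
  have lower_moment {q : ℝ} (hq₀ : 0 ≤ q) (hq : q ≤ t + s) :
      ∫ ω, f ω ^ q ∂μ ≤ (∫ ω, f ω ^ (t + s) ∂μ) ^ (q / (t + s)) := by
    refine (integral_congr_ae ?_).trans_le (integral_rpow_le_rpow_integral
      (hf₀.mono fun ω hω => Real.rpow_nonneg hω _) hf (by positivity) ((div_le_one hr).2 hq))
    filter_upwards [hf₀] with ω hω
    rw [← Real.rpow_mul hω, mul_div_cancel₀ q hr.ne']
  have h₁ := lower_moment zero_le_one hts
  simp only [Real.rpow_one] at h₁
  calc (∫ ω, f ω ^ t ∂μ) * (∫ ω, f ω ∂μ) ^ s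
      ≤ (∫ ω, f ω ^ (t + s) ∂μ) ^ (t / (t + s)) *
          ((∫ ω, f ω ^ (t + s) ∂μ) ^ (1 / (t + s))) ^ s := by
        have := integral_nonneg_of_ae hf₀
        gcongr
        exact lower_moment ht (le_add_of_nonneg_right hs)
    _ = ∫ ω, f ω ^ (t + s) ∂μ := by
        rw [← Real.rpow_mul hI, ← Real.rpow_add_of_nonneg hI (by positivity) (by positivity),
          one_div_mul_eq_div, ← add_div, div_self hr.ne', Real.rpow_one]

lemma integral_rpow_add_le_integral_rpow_mul (hf₀ : 0 ≤ᵐ[μ] f) (hmean : 0 < ∫ ω, f ω ∂μ)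
    (ht : 1 ≤ t) (hs : s ≤ 0) (hts : 0 ≤ t + s) (hf : Integrable (fun ω => f ω ^ t) μ) :
    ∫ ω, f ω ^ (t + s) ∂μ ≤ (∫ ω, f ω ^ t ∂μ) * (∫ ω, f ω ∂μ) ^ s := by
  have h := integral_rpow_mul_rpow_integral_le (t := t + s) (s := -s) hf₀ hts
    (neg_nonneg.2 hs) (by simpa using ht) (by simpa using hf)
  rwa [add_neg_cancel_right, Real.rpow_neg hmean.le, ← div_eq_mul_inv,
    div_le_iff₀ (Real.rpow_pos_of_pos hmean s)] at h

lemma integral_pos_of_mem_Icc (hfm : AEMeasurable f μ) (hlo : 0 < lo)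
    (hf : ∀ᵐ ω ∂μ, f ω ∈ Set.Icc lo hi) : 0 < ∫ ω, f ω ∂μ :=
  hlo.trans_le ((convex_Icc lo hi).integral_mem isClosed_Icc hf
    (Integrable.of_mem_Icc lo hi hfm hf)).1

lemma rpow_integral_lt_integral_rpow_of_neg (hfm : AEMeasurable f μ) (hlo : 0 < lo)
    (hf : ∀ᵐ ω ∂μ, f ω ∈ Set.Icc lo hi) (hne : ¬ ∃ c, ∀ᵐ ω ∂μ, f ω = c) (hq : q < 0) :
    (∫ ω, f ω ∂μ) ^ q < ∫ ω, f ω ^ q ∂μ := by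
  have hpos : ∀ x ∈ Set.Icc lo hi, 0 < x := fun x hx => hlo.trans_le hx.1
  have hconv := (strictConvexOn_rpow_of_neg hq).subset hpos (convex_Icc lo hi)
  have hcont : ContinuousOn (fun x : ℝ => x ^ q) (Set.Icc lo hi) :=
    continuousOn_id.rpow_const fun x hx => Or.inl (hpos x hx).ne'
  rcases hconv.ae_eq_const_or_map_average_lt hcont isClosed_Icc hf
      (Integrable.of_mem_Icc lo hi hfm hf) (integrable_rpow_of_mem_Icc hfm hlo hf q) with h | h
  · exact absurd ⟨_, h⟩ hne
  · simpa only [average_eq_integral] using h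

lemma integral_rpow_add_lt_integral_rpow_mul (hfm : AEMeasurable f μ) (hlo : 0 < lo)
    (hf : ∀ᵐ ω ∂μ, f ω ∈ Set.Icc lo hi) (hne : ¬ ∃ c, ∀ᵐ ω ∂μ, f ω = c) (hs : 0 < s)
    (hts : t + s < 0) :
    ∫ ω, f ω ^ (t + s) ∂μ < (∫ ω, f ω ^ t ∂μ) * (∫ ω, f ω ∂μ) ^ s := by
  have ht : t < 0 := by linarith
  have hst : s / t < 0 := div_neg_of_pos_of_neg hs ht
  have hmean : 0 < ∫ ω, f ω ∂μ := integral_pos_of_mem_Icc hfm hlo hf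
  have hJensen := rpow_integral_lt_integral_rpow_of_neg hfm hlo hf hne ht
  have hI : 0 < ∫ ω, f ω ^ t ∂μ := (Real.rpow_pos_of_pos hmean t).trans hJensen
  -- Jensen for the concave power `1 + s / t` of `f ^ t`, then for the convex power `t` of `f`.
  calc ∫ ω, f ω ^ (t + s) ∂μ = ∫ ω, (f ω ^ t) ^ (1 + s / t) ∂μ := by
        refine integral_congr_ae ?_
        filter_upwards [hf] with ω hω
        rw [← Real.rpow_mul (hlo.trans_le hω.1).le, mul_one_add, mul_div_cancel₀ s ht.ne]
    _ ≤ (∫ ω, f ω ^ t ∂μ) ^ (1 + s / t) := by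
        refine integral_rpow_le_rpow_integral
          (hf.mono fun ω hω => Real.rpow_nonneg (hlo.trans_le hω.1).le t)
          (integrable_rpow_of_mem_Icc hfm hlo hf t) ?_ (by linarith)
        rw [one_add_div ht.ne]
        exact div_nonneg_of_nonpos hts.le ht.le
    _ = (∫ ω, f ω ^ t ∂μ) * (∫ ω, f ω ^ t ∂μ) ^ (s / t) := by
        rw [Real.rpow_add hI, Real.rpow_one]
    _ < (∫ ω, f ω ^ t ∂μ) * ((∫ ω, f ω ∂μ) ^ t) ^ (s / t) := by
        gcongr ?_ * ?_
        exact Real.rpow_lt_rpow_of_neg (Real.rpow_pos_of_pos hmean t) hJensen hst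
    _ = (∫ ω, f ω ^ t ∂μ) * (∫ ω, f ω ∂μ) ^ s := by
        rw [← Real.rpow_mul hmean.le, mul_div_cancel₀ s ht.ne]

lemma integral_rpow_mul_lt_integral_rpow_add (hfm : AEMeasurable f μ) (hlo : 0 < lo)
    (hf : ∀ᵐ ω ∂μ, f ω ∈ Set.Icc lo hi) (hne : ¬ ∃ c, ∀ᵐ ω ∂μ, f ω = c) (ht : t < 0)
    (hs : s < 0) :
    (∫ ω, f ω ^ t ∂μ) * (∫ ω, f ω ∂μ) ^ s < ∫ ω, f ω ^ (t + s) ∂μ := by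
  have hmean := integral_pos_of_mem_Icc hfm hlo hf
  have h := integral_rpow_add_lt_integral_rpow_mul (t := t + s) (s := -s) hfm hlo hf hne
    (neg_pos.2 hs) (by simpa using ht)
  rwa [add_neg_cancel_right, Real.rpow_neg hmean.le, ← div_eq_mul_inv,
    lt_div_iff₀ (Real.rpow_pos_of_pos hmean s)] at h

end MomentInequalities

section Posterior

lemma ae_compProd_of_ae_bind {Ω M : Type*} [MeasurableSpace Ω] [MeasurableSpace M]
    {p : Measure Ω} [SFinite p] {K : Kernel Ω M} [IsSFiniteKernel K] {P : M → Prop}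
    (hP : ∀ᵐ m ∂(p.bind K), P m) : ∀ᵐ z ∂(p.compProd K), P z.2 := by
  rw [← Measure.snd_compProd] at hP
  exact ae_of_ae_map measurable_snd.aemeasurable hP

lemma integrable_compProd_fst {Ω M : Type*} [MeasurableSpace Ω] [MeasurableSpace M]
    {p : Measure Ω} [SFinite p] {K : Kernel Ω M} [IsMarkovKernel K] {g : Ω → ℝ}
    (hg : Integrable g p) : Integrable (fun z : Ω × M => g z.1) (p.compProd K) := by
  rw [← Measure.fst_compProd p K] at hg
  exact hg.comp_measurable measurable_fst

variable {Ω M : Type*} [MeasurableSpace Ω] [StandardBorelSpace Ω] [Nonempty Ω]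
  [MeasurableSpace M] {p : Measure Ω} [IsFiniteMeasure p] {K : Kernel Ω M}

lemma ae_posterior_of_ae [IsMarkovKernel K] {P : Ω → Prop} (hP : ∀ᵐ ω ∂p, P ω) :
    ∀ᵐ m ∂(p.bind K), ∀ᵐ ω ∂(posterior K p m), P ω :=
  Measure.ae_ae_of_ae_comp (by rwa [posterior_comp_self])

lemma compProd_eq_map_swap_posterior [IsFiniteKernel K] :
    p.compProd K = ((p.bind K).compProd (posterior K p)).map Prod.swap := by
  rw [compProd_posterior_eq_map_swap, Measure.map_map measurable_swap measurable_swap,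
    Prod.swap_swap_eq, Measure.map_id]

lemma integrable_integral_posterior [IsFiniteKernel K] {F : Ω × M → ℝ}
    (hF : Integrable F (p.compProd K)) :
    Integrable (fun m => ∫ ω, F (ω, m) ∂(posterior K p m)) (p.bind K) := by
  rw [compProd_eq_map_swap_posterior] at hF
  have hswap := hF.comp_measurable measurable_swap
  rw [Measure.compProd] at hswap
  exact hswap.integral_compProd

lemma integral_compProd_eq_integral_posterior [IsFiniteKernel K] {F : Ω × M → ℝ}
    (hF : Integrable F (p.compProd K)) :
    ∫ z, F z ∂(p.compProd K) = ∫ m, ∫ ω, F (ω, m) ∂(posterior K p m) ∂(p.bind K) := by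
  rw [compProd_eq_map_swap_posterior] at hF ⊢
  rw [integral_map measurable_swap.aemeasurable hF.aestronglyMeasurable]
  exact Measure.integral_compProd (hF.comp_measurable measurable_swap)

lemma integral_integral_posterior [IsMarkovKernel K] {g : Ω → ℝ} (hg : Integrable g p) :
    ∫ m, ∫ ω, g ω ∂(posterior K p m) ∂(p.bind K) = ∫ ω, g ω ∂p := by
  rw [← integral_compProd_eq_integral_posterior (integrable_compProd_fst (K := K) hg),
    Measure.integral_compProd (integrable_compProd_fst hg)]
  simp

lemma posterior_const [IsProbabilityMeasure p] (ν : Measure M) [IsProbabilityMeasure ν] :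
    ∀ᵐ m ∂ν, posterior (Kernel.const Ω ν) p m = p := by
  have h := ae_eq_posterior_of_compProd_eq (μ := p) (κ := Kernel.const Ω ν)
    (η := Kernel.const M p) (by simp [Measure.compProd_const, Measure.prod_swap])
  simp only [Measure.const_comp, measure_univ, one_smul] at h
  filter_upwards [h] with m hm
  rw [← hm, Kernel.const_apply]

end Posterior

section MeanPersuasion

/-- A persuasion problem with states in `S` in which the receiver's unique best response to a belief
is a function `α` of the posterior mean of a statistic `h` of the state. The means range over the
compact convex set `I`. -/
structure IsMeanPersuasion (A : Set ℝ) (U V : ℝ → ℝ → ℝ) (S I : Set ℝ) (h α : ℝ → ℝ) : Prop where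
  measurable_statistic : Measurable h
  measurable_response : Measurable α
  measurable_utility : Measurable fun z : ℝ × ℝ => V z.1 z.2
  mapsTo : Set.MapsTo h S I
  isCompact : IsCompact I
  convex : Convex ℝ I
  bounded : ∃ C, ∀ ω ∈ S, ∀ x ∈ I, |V ω (α x)| ≤ C
  isBestResponse_iff (μ : Measure ℝ) [IsProbabilityMeasure μ] (hμ : ∀ᵐ ω ∂μ, ω ∈ S) (a : ℝ) :
    IsBestResponse A U μ a ↔ a = α (∫ ω, h ω ∂μ)

/-- The sender's expected utility at the belief `μ`, when the receiver best responds to `μ`. -/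
noncomputable def senderValue (V : ℝ → ℝ → ℝ) (h α : ℝ → ℝ) (μ : Measure ℝ) : ℝ :=
  ∫ ω, V ω (α (∫ ω', h ω' ∂μ)) ∂μ

/-- The sender's expected utility at the belief `μ`, when the state is revealed to the receiver. -/
noncomputable def disclosedValue (V : ℝ → ℝ → ℝ) (h α : ℝ → ℝ) (μ : Measure ℝ) : ℝ :=
  ∫ ω, V ω (α (h ω)) ∂μ

namespace IsMeanPersuasion

variable {A S I : Set ℝ} {U V : ℝ → ℝ → ℝ} {h α : ℝ → ℝ} {p : Measure ℝ} [IsProbabilityMeasure p]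
  {M : Type*} [MeasurableSpace M] {K : Kernel ℝ M} [IsMarkovKernel K] {v : ℝ}

lemma integral_statistic_mem (H : IsMeanPersuasion A U V S I h α) (hp : ∀ᵐ ω ∂p, ω ∈ S) :
    ∫ ω, h ω ∂p ∈ I := by
  have hmem : ∀ᵐ ω ∂p, h ω ∈ I := hp.mono fun _ hω => H.mapsTo hω
  obtain ⟨C, hC⟩ := H.isCompact.isBounded.exists_norm_le
  exact H.convex.integral_mem H.isCompact.isClosed hmem <|
    Integrable.of_bound H.measurable_statistic.aestronglyMeasurable C (hmem.mono fun _ => hC _)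

lemma measurable_response_posterior (H : IsMeanPersuasion A U V S I h α) :
    Measurable fun m => α (∫ ω, h ω ∂(posterior K p m)) :=
  H.measurable_response.comp
    (StronglyMeasurable.integral_kernel H.measurable_statistic.stronglyMeasurable).measurable

lemma integrable_utility (H : IsMeanPersuasion A U V S I h α) (hp : ∀ᵐ ω ∂p, ω ∈ S) :
    Integrable (fun z : ℝ × M => V z.1 (α (∫ ω, h ω ∂(posterior K p z.2)))) (p.compProd K) := by
  obtain ⟨C, hC⟩ := H.bounded
  have hmeas : Measurable fun z : ℝ × M => V z.1 (α (∫ ω, h ω ∂(posterior K p z.2))) :=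
    H.measurable_utility.comp
      (measurable_fst.prodMk (H.measurable_response_posterior.comp measurable_snd))
  refine Integrable.of_bound hmeas.aestronglyMeasurable C ?_
  have hstate : ∀ᵐ z ∂(p.compProd K), z.1 ∈ S := by
    rw [← Measure.fst_compProd p K] at hp
    exact ae_of_ae_map measurable_fst.aemeasurable hp
  have hmean : ∀ᵐ z ∂(p.compProd K), ∫ ω, h ω ∂(posterior K p z.2) ∈ I :=
    ae_compProd_of_ae_bind <| (ae_posterior_of_ae hp).mono fun _ => H.integral_statistic_mem
  filter_upwards [hstate, hmean] with z hz hz' using hC _ hz _ hz'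

lemma integrable_disclosed (H : IsMeanPersuasion A U V S I h α) (hp : ∀ᵐ ω ∂p, ω ∈ S) :
    Integrable (fun ω => V ω (α (h ω))) p := by
  obtain ⟨C, hC⟩ := H.bounded
  have hmeas : Measurable fun ω => V ω (α (h ω)) := H.measurable_utility.comp
    (measurable_id.prodMk (H.measurable_response.comp H.measurable_statistic))
  exact Integrable.of_bound hmeas.aestronglyMeasurable C
    (hp.mono fun ω hω => hC ω hω _ (H.mapsTo hω))

lemma isOptimalPlan_iff (H : IsMeanPersuasion A U V S I h α) (hp : ∀ᵐ ω ∂p, ω ∈ S) {σ : M → ℝ} :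
    IsOptimalPlan A U p K σ ↔
      Measurable σ ∧ ∀ᵐ m ∂(p.bind K), σ m = α (∫ ω, h ω ∂(posterior K p m)) := by
  have hiff : (∀ᵐ m ∂(p.bind K), IsBestResponse A U (posterior K p m) (σ m)) ↔
      ∀ᵐ m ∂(p.bind K), σ m = α (∫ ω, h ω ∂(posterior K p m)) :=
    Filter.eventually_congr <|
      (ae_posterior_of_ae hp).mono fun m hm => H.isBestResponse_iff _ hm (σ m)
  rw [← hiff]
  exact ⟨fun hσ => ⟨hσ.measurable, hσ.optimal⟩, fun hσ => ⟨hσ.1, hσ.2⟩⟩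

theorem isSenderPayoff_iff (H : IsMeanPersuasion A U V S I h α) (hp : ∀ᵐ ω ∂p, ω ∈ S) :
    IsSenderPayoff A U V p K v ↔ v = ∫ m, senderValue V h α (posterior K p m) ∂(p.bind K) := by
  have hvalue := integral_compProd_eq_integral_posterior (H.integrable_utility (K := K) hp)
  simp only [senderValue, ← hvalue]
  constructor
  · rintro ⟨σ, hσ, -, rfl⟩
    refine integral_congr_ae ?_
    filter_upwards [ae_compProd_of_ae_bind ((H.isOptimalPlan_iff hp).1 hσ).2] with z hz
    rw [hz]
  · rintro rfl
    exact ⟨fun m => α (∫ ω, h ω ∂(posterior K p m)),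
      (H.isOptimalPlan_iff hp).2 ⟨H.measurable_response_posterior, ae_of_all _ fun _ => rfl⟩,
      H.integrable_utility hp, rfl⟩

theorem isWellPosed (H : IsMeanPersuasion A U V S I h α) (hp : ∀ᵐ ω ∂p, ω ∈ S) :
    IsWellPosed.{u} A U V p := fun _ _ _ _ =>
  ⟨_, (H.isSenderPayoff_iff hp).2 rfl, fun _ => (H.isSenderPayoff_iff hp).1⟩

lemma isSenderPayoff_fullDisclosure_iff (H : IsMeanPersuasion A U V S I h α)
    (hp : ∀ᵐ ω ∂p, ω ∈ S) :
    IsSenderPayoff A U V p fullDisclosure v ↔ v = disclosedValue V h α p := by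
  rw [H.isSenderPayoff_iff hp, Measure.id_comp]
  suffices ∫ ω, senderValue V h α (posterior fullDisclosure p ω) ∂p = disclosedValue V h α p by
    rw [this]
  refine integral_congr_ae ?_
  filter_upwards [posterior_id p] with ω hω
  simp only [hω, Kernel.id_apply, senderValue, integral_dirac]

lemma isSenderPayoff_const_iff (H : IsMeanPersuasion A U V S I h α) (hp : ∀ᵐ ω ∂p, ω ∈ S)
    (ν : Measure M) [IsProbabilityMeasure ν] :
    IsSenderPayoff A U V p (Kernel.const ℝ ν) v ↔ v = senderValue V h α p := by
  rw [H.isSenderPayoff_iff hp, Measure.const_comp, measure_univ, one_smul]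
  suffices ∫ m, senderValue V h α (posterior (Kernel.const ℝ ν) p m) ∂ν = senderValue V h α p by
    rw [this]
  rw [integral_congr_ae ((posterior_const ν).mono fun m hm => congrArg (senderValue V h α) hm)]
  simp

lemma integrable_senderValue_posterior (H : IsMeanPersuasion A U V S I h α)
    (hp : ∀ᵐ ω ∂p, ω ∈ S) :
    Integrable (fun m => senderValue V h α (posterior K p m)) (p.bind K) :=
  integrable_integral_posterior (F := fun z => V z.1 (α (∫ ω, h ω ∂(posterior K p z.2))))
    (H.integrable_utility hp)

lemma integrable_disclosedValue_posterior (H : IsMeanPersuasion A U V S I h α)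
    (hp : ∀ᵐ ω ∂p, ω ∈ S) :
    Integrable (fun m => disclosedValue V h α (posterior K p m)) (p.bind K) :=
  integrable_integral_posterior (F := fun z => V z.1 (α (h z.1)))
    (integrable_compProd_fst (H.integrable_disclosed hp))

theorem fullDisclosureOptimal (H : IsMeanPersuasion A U V S I h α) (hp : ∀ᵐ ω ∂p, ω ∈ S)
    (hle : ∀ (μ : Measure ℝ) [IsProbabilityMeasure μ], (∀ᵐ ω ∂μ, ω ∈ S) →
      senderValue V h α μ ≤ disclosedValue V h α μ) :
    FullDisclosureOptimal.{u} A U V p := by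
  refine ⟨_, (H.isSenderPayoff_fullDisclosure_iff hp).2 rfl, fun M _ K _ v hv => ?_⟩
  calc v = ∫ m, senderValue V h α (posterior K p m) ∂(p.bind K) := (H.isSenderPayoff_iff hp).1 hv
    _ ≤ ∫ m, disclosedValue V h α (posterior K p m) ∂(p.bind K) :=
        integral_mono_ae (H.integrable_senderValue_posterior hp)
          (H.integrable_disclosedValue_posterior hp)
          ((ae_posterior_of_ae hp).mono fun m hm => hle _ hm)
    _ = disclosedValue V h α p := integral_integral_posterior (H.integrable_disclosed hp)

theorem fullDisclosureSuboptimal (H : IsMeanPersuasion A U V S I h α) (hp : ∀ᵐ ω ∂p, ω ∈ S)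
    (hlt : disclosedValue V h α p < senderValue V h α p) :
    FullDisclosureSuboptimal.{u} A U V p :=
  ⟨_, (H.isSenderPayoff_fullDisclosure_iff hp).2 rfl, PUnit, inferInstance,
    Kernel.const ℝ (Measure.dirac PUnit.unit), inferInstance, _,
    (H.isSenderPayoff_const_iff hp _).2 rfl, hlt⟩

end IsMeanPersuasion

end MeanPersuasion

section AgentProblem

variable {κ δ γ ω x a b lo hi aLo aHi : ℝ} {μ : Measure ℝ}

/-- The agent's optimal effort under a belief for which `ω ^ (1 - γ)` has expectation `x`. -/
noncomputable def optEffort (κ δ γ x : ℝ) : ℝ :=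
  (κ * δ ^ (1 - γ) * x) ^ (1 - κ * (1 - γ))⁻¹

lemma measurable_optEffort : Measurable (optEffort κ δ γ) := by
  unfold optEffort
  fun_prop

lemma optEffort_pos (hκ : 0 < κ) (hδ : 0 < δ) (hx : 0 < x) : 0 < optEffort κ δ γ x := by
  unfold optEffort
  positivity

lemma monotoneOn_optEffort (hκ : 0 < κ) (hθ : κ * (1 - γ) < 1) (hδ : 0 < δ) :
    MonotoneOn (optEffort κ δ γ) (Set.Ioi 0) := fun x (hx : 0 < x) y _ hxy => by
  have : 0 < 1 - κ * (1 - γ) := sub_pos.2 hθ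
  unfold optEffort
  gcongr

lemma mul_optEffort_rpow (hκ : 0 < κ) (hθ : κ * (1 - γ) < 1) (hδ : 0 < δ) (hx : 0 < x) :
    κ * δ ^ (1 - γ) * x * optEffort κ δ γ x ^ (κ * (1 - γ)) = optEffort κ δ γ x := by
  have hc : 0 < κ * δ ^ (1 - γ) * x := by positivity
  have hθ' : 1 - κ * (1 - γ) ≠ 0 := (sub_pos.2 hθ).ne'
  have hexp : 1 + (1 - κ * (1 - γ))⁻¹ * (κ * (1 - γ)) = (1 - κ * (1 - γ))⁻¹ := by
    field_simp
    ring
  rw [optEffort, ← Real.rpow_mul hc.le,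
    ← Real.rpow_one_add' hc.le (by rw [hexp]; exact inv_ne_zero hθ'), hexp]

lemma agentUtility_eq (hκ : κ ≠ 0) (hδ : 0 ≤ δ) (hω : 0 ≤ ω) (ha : 0 ≤ a) :
    agentUtility κ δ γ ω a =
      κ * δ ^ (1 - γ) * ω ^ (1 - γ) * (a ^ (κ * (1 - γ)) / (κ * (1 - γ))) - a := by
  rw [agentUtility, crra, wage, output, Real.mul_rpow hδ (by positivity),
    Real.mul_rpow hω (by positivity), ← Real.rpow_mul ha]
  field_simp

lemma hasDerivAt_agentUtility (hκ : κ ≠ 0) (hδ : 0 ≤ δ) (hγ : γ ≠ 1) (hω : 0 ≤ ω) (ha : 0 < a) :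
    HasDerivAt (agentUtility κ δ γ ω)
      (κ * δ ^ (1 - γ) * ω ^ (1 - γ) * a ^ (κ * (1 - γ) - 1) - 1) a := by
  have hθ : κ * (1 - γ) ≠ 0 := mul_ne_zero hκ (sub_ne_zero.2 hγ.symm)
  have hpow : HasDerivAt (fun a => a ^ (κ * (1 - γ)) / (κ * (1 - γ)))
      (a ^ (κ * (1 - γ) - 1)) a := by
    rw [← mul_div_cancel_left₀ (a ^ (κ * (1 - γ) - 1)) hθ]
    exact (Real.hasDerivAt_rpow_const (Or.inl ha.ne')).div_const _
  refine ((hpow.const_mul _).sub (hasDerivAt_id a)).congr_of_eventuallyEq ?_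
  filter_upwards [lt_mem_nhds ha] with b hb using agentUtility_eq hκ hδ hω hb.le

lemma eq_optEffort_of_hasDerivAt (hκ : κ ≠ 0) (hθ : κ * (1 - γ) < 1) (hδ : 0 ≤ δ) (hγ : γ ≠ 1)
    (hω : 0 ≤ ω) (ha : 0 < a) (h : HasDerivAt (agentUtility κ δ γ ω) 0 a) :
    a = optEffort κ δ γ (ω ^ (1 - γ)) := by
  have hfoc := (hasDerivAt_agentUtility hκ hδ hγ hω ha).unique h
  have hc : κ * δ ^ (1 - γ) * ω ^ (1 - γ) = a ^ (1 - κ * (1 - γ)) := by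
    rw [← neg_sub (κ * (1 - γ)), Real.rpow_neg ha.le]
    exact eq_inv_of_mul_eq_one_left (sub_eq_zero.1 hfoc)
  rw [optEffort, hc, ← Real.rpow_mul ha.le, mul_inv_cancel₀ (sub_pos.2 hθ).ne', Real.rpow_one]

lemma optEffort_mem_effortSet (hκ : 0 < κ) (hθ : κ * (1 - γ) < 1) (hδ : 0 < δ) (hγ : γ ≠ 1)
    (hlo : 0 < lo) (hlohi : lo ≤ hi)
    (hint : ∀ ω ∈ Set.Icc lo hi, ∃ a ∈ Set.Icc aLo aHi,
      0 < a ∧ HasDerivAt (agentUtility κ δ γ ω) 0 a)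
    (hx : x ∈ Set.uIcc (lo ^ (1 - γ)) (hi ^ (1 - γ))) :
    optEffort κ δ γ x ∈ effortSet γ aLo aHi := by
  have hmem : ∀ ω ∈ Set.Icc lo hi, optEffort κ δ γ (ω ^ (1 - γ)) ∈ Set.Icc aLo aHi := by
    intro ω hω
    obtain ⟨a, ha, ha₀, hd⟩ := hint ω hω
    have hω₀ : 0 ≤ ω := hlo.le.trans hω.1
    rwa [← eq_optEffort_of_hasDerivAt hκ.ne' hθ hδ.le hγ hω₀ ha₀ hd]
  have hpos : ∀ y ∈ Set.uIcc (lo ^ (1 - γ)) (hi ^ (1 - γ)), 0 < y := fun y hy =>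
    pos_of_mem_uIcc_rpow hlo (hlo.trans_le hlohi) hy
  have hmono := (monotoneOn_optEffort (γ := γ) hκ hθ hδ).mono hpos
  exact ⟨Set.uIcc_subset_Icc (hmem lo ⟨le_rfl, hlohi⟩) (hmem hi ⟨hlohi, le_rfl⟩)
    (hmono.mapsTo_uIcc hx), fun _ => (optEffort_pos hκ hδ (hpos x hx)).ne'⟩

lemma integral_agentUtility [IsProbabilityMeasure μ] (hκ : κ ≠ 0) (hδ : 0 ≤ δ) (hlo : 0 < lo)
    (hμ : ∀ᵐ ω ∂μ, ω ∈ Set.Icc lo hi) (ha : 0 ≤ a) :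
    ∫ ω, agentUtility κ δ γ ω a ∂μ =
      κ * δ ^ (1 - γ) * (∫ ω, ω ^ (1 - γ) ∂μ) * (a ^ (κ * (1 - γ)) / (κ * (1 - γ))) - a := by
  have hU : ∀ᵐ ω ∂μ, agentUtility κ δ γ ω a =
      κ * δ ^ (1 - γ) * ω ^ (1 - γ) * (a ^ (κ * (1 - γ)) / (κ * (1 - γ))) - a :=
    hμ.mono fun ω hω => agentUtility_eq hκ hδ (hlo.le.trans hω.1) ha
  have hX := integrable_rpow_of_mem_Icc aemeasurable_id hlo hμ (1 - γ)
  simp only [id_eq] at hX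
  rw [integral_congr_ae hU, integral_sub ((hX.const_mul _).mul_const _) (integrable_const _),
    integral_mul_const, integral_const_mul]
  simp

lemma integral_agentUtility_lt_optEffort [IsProbabilityMeasure μ] (hκ : 0 < κ)
    (hθ : κ * (1 - γ) < 1) (hδ : 0 < δ) (hγ : γ ≠ 1) (hlo : 0 < lo)
    (hμ : ∀ᵐ ω ∂μ, ω ∈ Set.Icc lo hi) (hmean : 0 < ∫ ω, ω ^ (1 - γ) ∂μ) (hb : 0 ≤ b)
    (hb₀ : 1 < γ → b ≠ 0) (hne : b ≠ optEffort κ δ γ (∫ ω, ω ^ (1 - γ) ∂μ)) :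
    ∫ ω, agentUtility κ δ γ ω b ∂μ <
      ∫ ω, agentUtility κ δ γ ω (optEffort κ δ γ (∫ ω, ω ^ (1 - γ) ∂μ)) ∂μ := by
  have hpos := optEffort_pos (γ := γ) hκ hδ hmean
  rw [integral_agentUtility hκ.ne' hδ.le hlo hμ hb,
    integral_agentUtility hκ.ne' hδ.le hlo hμ hpos.le]
  exact mul_rpow_div_sub_lt (mul_ne_zero hκ.ne' (sub_ne_zero.2 hγ.symm)) hθ hpos
    (mul_optEffort_rpow hκ hθ hδ hmean) hb
    (fun h => hb₀ (sub_neg.1 (neg_of_mul_neg_right h hκ.le))) hne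

lemma isBestResponse_iff [IsProbabilityMeasure μ] (hκ : 0 < κ) (hθ : κ * (1 - γ) < 1)
    (hδ : 0 < δ) (hγ : γ ≠ 1) (hA : 0 ≤ aLo) (hlo : 0 < lo)
    (hμ : ∀ᵐ ω ∂μ, ω ∈ Set.Icc lo hi) (hmean : 0 < ∫ ω, ω ^ (1 - γ) ∂μ)
    (hopt : optEffort κ δ γ (∫ ω, ω ^ (1 - γ) ∂μ) ∈ effortSet γ aLo aHi) (a : ℝ) :
    IsBestResponse (effortSet γ aLo aHi) (agentUtility κ δ γ) μ a ↔
      a = optEffort κ δ γ (∫ ω, ω ^ (1 - γ) ∂μ) := by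
  have hlt : ∀ b ∈ effortSet γ aLo aHi, b ≠ optEffort κ δ γ (∫ ω, ω ^ (1 - γ) ∂μ) →
      ∫ ω, agentUtility κ δ γ ω b ∂μ <
        ∫ ω, agentUtility κ δ γ ω (optEffort κ δ γ (∫ ω, ω ^ (1 - γ) ∂μ)) ∂μ := fun b hb =>
    integral_agentUtility_lt_optEffort hκ hθ hδ hγ hlo hμ hmean (hA.trans hb.1.1) hb.2
  constructor
  · rintro ⟨ha, hmax⟩
    by_contra hne
    exact (hlt a ha hne).not_ge (hmax _ hopt)
  · rintro rfl
    refine ⟨hopt, fun b hb => ?_⟩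
    rcases eq_or_ne b (optEffort κ δ γ (∫ ω, ω ^ (1 - γ) ∂μ)) with rfl | hne
    exacts [le_rfl, (hlt b hb hne).le]

end AgentProblem

section PrincipalPayoff

variable {κ δ γ ρ ω x lo hi aLo aHi : ℝ} {μ : Measure ℝ}

/-- The exponent of the posterior mean of `ω ^ (1 - γ)` in the principal's utility from optimal
effort. -/
noncomputable def effortExponent (κ γ ρ : ℝ) : ℝ := κ * (1 - ρ) / (1 - κ * (1 - γ))

/-- The constant factor of the principal's utility from optimal effort, multiplied by `1 - ρ` so
that it is positive. -/
noncomputable def payoffScale (κ δ γ ρ : ℝ) : ℝ :=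
  (1 - δ) ^ (1 - ρ) * (κ * δ ^ (1 - γ)) ^ effortExponent κ γ ρ

lemma payoffScale_pos (hκ : 0 < κ) (hδ₀ : 0 < δ) (hδ₁ : δ < 1) : 0 < payoffScale κ δ γ ρ := by
  have : 0 < 1 - δ := sub_pos.2 hδ₁
  unfold payoffScale
  positivity

lemma principalUtility_optEffort (hκ : 0 < κ) (hδ₀ : 0 < δ) (hδ₁ : δ < 1) (hω : 0 ≤ ω)
    (hx : 0 < x) :
    principalUtility κ δ ρ ω (optEffort κ δ γ x) =
      payoffScale κ δ γ ρ / (1 - ρ) * (ω ^ (1 - ρ) * x ^ effortExponent κ γ ρ) := by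
  have hδ : 0 ≤ 1 - δ := (sub_pos.2 hδ₁).le
  have ha := optEffort_pos (γ := γ) hκ hδ₀ hx
  have heffort : (optEffort κ δ γ x ^ κ) ^ (1 - ρ) =
      (κ * δ ^ (1 - γ)) ^ effortExponent κ γ ρ * x ^ effortExponent κ γ ρ := by
    rw [← Real.rpow_mul ha.le, optEffort, ← Real.rpow_mul (by positivity),
      ← Real.mul_rpow (by positivity) hx.le, effortExponent, div_eq_inv_mul]
  rw [principalUtility, crra, wage, output, ← one_sub_mul, Real.mul_rpow hδ (by positivity),
    Real.mul_rpow hω (by positivity), heffort, payoffScale]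
  ring

lemma isMeanPersuasion_principalAgent (hκ : 0 < κ) (hθ : κ * (1 - γ) < 1) (hδ₀ : 0 < δ)
    (hδ₁ : δ < 1) (hγ : γ ≠ 1) (hlo : 0 < lo) (hlohi : lo ≤ hi) (hA : 0 ≤ aLo)
    (hint : ∀ ω ∈ Set.Icc lo hi, ∃ a ∈ Set.Icc aLo aHi,
      0 < a ∧ HasDerivAt (agentUtility κ δ γ ω) 0 a) :
    IsMeanPersuasion (effortSet γ aLo aHi) (agentUtility κ δ γ) (principalUtility κ δ ρ)
      (Set.Icc lo hi) (Set.uIcc (lo ^ (1 - γ)) (hi ^ (1 - γ))) (fun ω => ω ^ (1 - γ))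
      (optEffort κ δ γ) where
  measurable_statistic := by fun_prop
  measurable_response := measurable_optEffort
  measurable_utility := by
    unfold principalUtility crra output wage
    fun_prop
  mapsTo ω hω := rpow_mem_uIcc hlo hω _
  isCompact := isCompact_uIcc
  convex := convex_uIcc _ _
  bounded := by
    have hpos : ∀ x ∈ Set.uIcc (lo ^ (1 - γ)) (hi ^ (1 - γ)), 0 < x := fun x hx =>
      pos_of_mem_uIcc_rpow hlo (hlo.trans_le hlohi) hx
    obtain ⟨C, hC⟩ := (isCompact_Icc.prod isCompact_uIcc).exists_bound_of_continuousOn <|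
      (continuousOn_const (c := payoffScale κ δ γ ρ / (1 - ρ))).mul <|
        (continuousOn_fst.rpow_const fun z hz => Or.inl (hlo.trans_le hz.1.1).ne').mul
          (continuousOn_snd.rpow_const fun z hz => Or.inl (hpos z.2 hz.2).ne')
    refine ⟨C, fun ω hω x hx => ?_⟩
    rw [principalUtility_optEffort hκ hδ₀ hδ₁ (hlo.le.trans hω.1) (hpos x hx)]
    exact hC (ω, x) ⟨hω, hx⟩
  isBestResponse_iff μ _ hμ a := by
    have hmean : ∫ ω, ω ^ (1 - γ) ∂μ ∈ Set.uIcc (lo ^ (1 - γ)) (hi ^ (1 - γ)) :=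
      (convex_uIcc _ _).integral_mem isClosed_Icc (hμ.mono fun _ hω => rpow_mem_uIcc hlo hω _)
        (integrable_rpow_of_mem_Icc aemeasurable_id hlo hμ _)
    exact isBestResponse_iff hκ hθ hδ₀ hγ hA hlo hμ
      (pos_of_mem_uIcc_rpow hlo (hlo.trans_le hlohi) hmean)
      (optEffort_mem_effortSet hκ hθ hδ₀ hγ hlo hlohi hint hmean) a

end PrincipalPayoff

section ComparisonOfValues

variable {κ δ γ ρ lo hi : ℝ} {μ : Measure ℝ}

lemma senderValue_principalUtility (hκ : 0 < κ) (hδ₀ : 0 < δ) (hδ₁ : δ < 1) (hγ : γ ≠ 1)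
    (hμ : ∀ᵐ ω ∂μ, 0 ≤ ω) (hmean : 0 < ∫ ω, ω ^ (1 - γ) ∂μ) :
    senderValue (principalUtility κ δ ρ) (fun ω => ω ^ (1 - γ)) (optEffort κ δ γ) μ =
      payoffScale κ δ γ ρ / (1 - ρ) * ((∫ ω, (ω ^ (1 - γ)) ^ ((1 - ρ) / (1 - γ)) ∂μ) *
        (∫ ω, ω ^ (1 - γ) ∂μ) ^ effortExponent κ γ ρ) := by
  rw [senderValue, ← integral_mul_const, ← integral_const_mul]
  refine integral_congr_ae ?_
  filter_upwards [hμ] with ω hω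
  rw [principalUtility_optEffort hκ hδ₀ hδ₁ hω hmean, ← Real.rpow_mul hω,
    mul_div_cancel₀ _ (sub_ne_zero.2 hγ.symm)]

lemma disclosedValue_principalUtility (hκ : 0 < κ) (hδ₀ : 0 < δ) (hδ₁ : δ < 1) (hγ : γ ≠ 1)
    (hμ : ∀ᵐ ω ∂μ, 0 < ω) :
    disclosedValue (principalUtility κ δ ρ) (fun ω => ω ^ (1 - γ)) (optEffort κ δ γ) μ =
      payoffScale κ δ γ ρ / (1 - ρ) *
        ∫ ω, (ω ^ (1 - γ)) ^ ((1 - ρ) / (1 - γ) + effortExponent κ γ ρ) ∂μ := by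
  rw [disclosedValue, ← integral_const_mul]
  refine integral_congr_ae ?_
  filter_upwards [hμ] with ω hω
  have hX : 0 < ω ^ (1 - γ) := Real.rpow_pos_of_pos hω _
  rw [principalUtility_optEffort hκ hδ₀ hδ₁ hω.le hX, Real.rpow_add hX,
    ← Real.rpow_mul hω.le (1 - γ) ((1 - ρ) / (1 - γ)),
    mul_div_cancel₀ _ (sub_ne_zero.2 hγ.symm)]

lemma div_add_effortExponent (hγ : γ ≠ 1) (hθ : κ * (1 - γ) ≠ 1) :
    (1 - ρ) / (1 - γ) + effortExponent κ γ ρ = (1 - ρ) / ((1 - γ) * (1 - κ * (1 - γ))) := by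
  rw [effortExponent, div_add_div _ _ (sub_ne_zero.2 hγ.symm) (sub_ne_zero.2 hθ.symm)]
  congr 1
  ring

variable [IsProbabilityMeasure μ]

lemma exists_ae_rpow_mem_Icc (hlo : 0 < lo) (hμ : ∀ᵐ ω ∂μ, ω ∈ Set.Icc lo hi) (q : ℝ) :
    ∃ a b, 0 < a ∧ ∀ᵐ ω ∂μ, ω ^ q ∈ Set.Icc a b := by
  obtain ⟨ω, hω⟩ := hμ.exists
  have hhi : 0 < hi := hlo.trans_le (hω.1.trans hω.2)
  exact ⟨_, _, lt_min (Real.rpow_pos_of_pos hlo q) (Real.rpow_pos_of_pos hhi q),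
    hμ.mono fun _ hω => rpow_mem_uIcc hlo hω q⟩

lemma senderValue_le_disclosedValue_of_lt_one (hκ : 0 < κ) (hθ : κ * (1 - γ) < 1) (hδ₀ : 0 < δ)
    (hδ₁ : δ < 1) (hγ : γ < 1) (hρ : (1 - γ) * (1 - κ * (1 - γ)) ≤ 1 - ρ) (hlo : 0 < lo)
    (hμ : ∀ᵐ ω ∂μ, ω ∈ Set.Icc lo hi) :
    senderValue (principalUtility κ δ ρ) (fun ω => ω ^ (1 - γ)) (optEffort κ δ γ) μ ≤
      disclosedValue (principalUtility κ δ ρ) (fun ω => ω ^ (1 - γ)) (optEffort κ δ γ) μ := by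
  have hμ₀ : ∀ᵐ ω ∂μ, 0 < ω := hμ.mono fun ω hω => hlo.trans_le hω.1
  obtain ⟨a, b, ha, hX⟩ := exists_ae_rpow_mem_Icc hlo hμ (1 - γ)
  have hXm : AEMeasurable (fun ω : ℝ => ω ^ (1 - γ)) μ := by fun_prop
  have hg : 0 < 1 - γ := sub_pos.2 hγ
  have hd : 0 < 1 - κ * (1 - γ) := sub_pos.2 hθ
  have hr : 0 < 1 - ρ := (mul_pos hg hd).trans_le hρ
  have hscale : 0 ≤ payoffScale κ δ γ ρ / (1 - ρ) := (div_pos (payoffScale_pos hκ hδ₀ hδ₁) hr).le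
  rw [senderValue_principalUtility hκ hδ₀ hδ₁ hγ.ne (hμ₀.mono fun _ => le_of_lt)
    (integral_pos_of_mem_Icc hXm ha hX), disclosedValue_principalUtility hκ hδ₀ hδ₁ hγ.ne hμ₀]
  refine mul_le_mul_of_nonneg_left (integral_rpow_mul_rpow_integral_le
    (hX.mono fun _ hω => ha.le.trans hω.1) (div_pos hr hg).le
    (div_pos (mul_pos hκ hr) hd).le ?_ (integrable_rpow_of_mem_Icc hXm ha hX _)) hscale
  rw [div_add_effortExponent hγ.ne hθ.ne]
  exact (one_le_div (mul_pos hg hd)).2 hρ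

lemma senderValue_le_disclosedValue_of_one_lt (hκ : 0 < κ) (hδ₀ : 0 < δ) (hδ₁ : δ < 1)
    (hγ : 1 < γ) (hρ : γ ≤ ρ) (hlo : 0 < lo) (hμ : ∀ᵐ ω ∂μ, ω ∈ Set.Icc lo hi) :
    senderValue (principalUtility κ δ ρ) (fun ω => ω ^ (1 - γ)) (optEffort κ δ γ) μ ≤
      disclosedValue (principalUtility κ δ ρ) (fun ω => ω ^ (1 - γ)) (optEffort κ δ γ) μ := by
  have hμ₀ : ∀ᵐ ω ∂μ, 0 < ω := hμ.mono fun ω hω => hlo.trans_le hω.1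
  obtain ⟨a, b, ha, hX⟩ := exists_ae_rpow_mem_Icc hlo hμ (1 - γ)
  have hXm : AEMeasurable (fun ω : ℝ => ω ^ (1 - γ)) μ := by fun_prop
  have hmean := integral_pos_of_mem_Icc hXm ha hX
  have hg : 1 - γ < 0 := sub_neg.2 hγ
  have hr : 1 - ρ < 0 := sub_neg.2 (hγ.trans_le hρ)
  have hθ : κ * (1 - γ) < 0 := mul_neg_of_pos_of_neg hκ hg
  have hd : 0 < 1 - κ * (1 - γ) := sub_pos.2 (hθ.trans one_pos)
  have hscale : payoffScale κ δ γ ρ / (1 - ρ) ≤ 0 :=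
    (div_neg_of_pos_of_neg (payoffScale_pos hκ hδ₀ hδ₁) hr).le
  rw [senderValue_principalUtility hκ hδ₀ hδ₁ hγ.ne' (hμ₀.mono fun _ => le_of_lt) hmean,
    disclosedValue_principalUtility hκ hδ₀ hδ₁ hγ.ne' hμ₀]
  refine mul_le_mul_of_nonpos_left (integral_rpow_add_le_integral_rpow_mul
    (hX.mono fun _ hω => ha.le.trans hω.1) hmean
    ((one_le_div_of_neg hg).2 (sub_le_sub_left hρ 1))
    (div_neg_of_neg_of_pos (mul_neg_of_pos_of_neg hκ hr) hd).le ?_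
    (integrable_rpow_of_mem_Icc hXm ha hX _)) hscale
  rw [div_add_effortExponent hγ.ne' (hθ.trans one_pos).ne]
  exact (div_pos_of_neg_of_neg hr (mul_neg_of_neg_of_pos hg hd)).le

lemma not_ae_rpow_eq_const {p : Measure ℝ} {q : ℝ} (hq : q ≠ 0) (hp : ∀ᵐ ω ∂p, 0 ≤ ω)
    (hne : ¬ ∃ c, ∀ᵐ ω ∂p, ω = c) : ¬ ∃ c, ∀ᵐ ω ∂p, ω ^ q = c := by
  rintro ⟨c, hc⟩
  refine hne ⟨c ^ q⁻¹, ?_⟩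
  filter_upwards [hp, hc] with ω hω hωc
  rw [← hωc, Real.rpow_rpow_inv hω hq]

lemma disclosedValue_lt_senderValue (hκ : 0 < κ) (hθ : κ * (1 - γ) < 1) (hδ₀ : 0 < δ)
    (hδ₁ : δ < 1) (h : ρ < 1 ∧ 1 < γ ∨ γ < 1 ∧ 1 < ρ) (hlo : 0 < lo)
    (hμ : ∀ᵐ ω ∂μ, ω ∈ Set.Icc lo hi) (hne : ¬ ∃ c, ∀ᵐ ω ∂μ, ω = c) :
    disclosedValue (principalUtility κ δ ρ) (fun ω => ω ^ (1 - γ)) (optEffort κ δ γ) μ <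
      senderValue (principalUtility κ δ ρ) (fun ω => ω ^ (1 - γ)) (optEffort κ δ γ) μ := by
  have hγ : γ ≠ 1 := h.elim (fun h => h.2.ne') (fun h => h.1.ne)
  have hμ₀ : ∀ᵐ ω ∂μ, 0 < ω := hμ.mono fun ω hω => hlo.trans_le hω.1
  obtain ⟨a, b, ha, hX⟩ := exists_ae_rpow_mem_Icc hlo hμ (1 - γ)
  have hXm : AEMeasurable (fun ω : ℝ => ω ^ (1 - γ)) μ := by fun_prop
  have hXne := not_ae_rpow_eq_const (sub_ne_zero.2 hγ.symm) (hμ₀.mono fun _ => le_of_lt) hne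
  have hd : 0 < 1 - κ * (1 - γ) := sub_pos.2 hθ
  have hscale := payoffScale_pos (γ := γ) (ρ := ρ) hκ hδ₀ hδ₁
  rw [senderValue_principalUtility hκ hδ₀ hδ₁ hγ (hμ₀.mono fun _ => le_of_lt)
    (integral_pos_of_mem_Icc hXm ha hX), disclosedValue_principalUtility hκ hδ₀ hδ₁ hγ hμ₀]
  rcases h with ⟨hρ, hγ₁⟩ | ⟨hγ₁, hρ⟩
  · have hr : 0 < 1 - ρ := sub_pos.2 hρ
    refine mul_lt_mul_of_pos_left (integral_rpow_add_lt_integral_rpow_mul hXm ha hX hXne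
      (div_pos (mul_pos hκ hr) hd) ?_) (div_pos hscale hr)
    rw [div_add_effortExponent hγ hθ.ne]
    exact div_neg_of_pos_of_neg hr (mul_neg_of_neg_of_pos (sub_neg.2 hγ₁) hd)
  · have hr : 1 - ρ < 0 := sub_neg.2 hρ
    exact mul_lt_mul_of_neg_left (integral_rpow_mul_lt_integral_rpow_add hXm ha hX hXne
      (div_neg_of_neg_of_pos hr (sub_pos.2 hγ₁))
      (div_neg_of_neg_of_pos (mul_neg_of_pos_of_neg hκ hr) hd)) (div_neg_of_pos_of_neg hscale hr)

end ComparisonOfValues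

lemma not_ae_eq_const_of_mem_support {Ω : Type*} [TopologicalSpace Ω] [T1Space Ω]
    [MeasurableSpace Ω] {p : Measure Ω} {ω₁ ω₂ : Ω} (h₁ : ω₁ ∈ p.support) (h₂ : ω₂ ∈ p.support)
    (hne : ω₁ ≠ ω₂) : ¬ ∃ c, ∀ᵐ ω ∂p, ω = c := by
  rintro ⟨c, hc⟩
  have hsub : p.support ⊆ {c} := Measure.support_subset_of_isClosed isClosed_singleton hc
  exact hne ((hsub h₁).trans (hsub h₂).symm)

end Persuasion

theorem mainTheorem5_general {κ δ γ ρ : ℝ} (hκ : 0 < κ) (hθ : κ * (1 - γ) < 1) (hδ₀ : 0 < δ)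
    (hδ₁ : δ < 1) (hγ₁ : γ ≠ 1) (hρ₁ : ρ ≠ 1) {ωLo ωHi : ℝ} (hΩ : 0 < ωLo) (hΩ' : ωLo ≤ ωHi)
    {aLo aHi : ℝ} (hA : 0 ≤ aLo)
    (hint : ∀ ω ∈ Set.Icc ωLo ωHi, ∃ a ∈ Set.Icc aLo aHi,
      0 < a ∧ HasDerivAt (Persuasion.agentUtility κ δ γ ω) 0 a)
    {p : Measure ℝ} [IsProbabilityMeasure p] (hp : ∀ᵐ ω ∂p, ω ∈ Set.Icc ωLo ωHi) :
    Persuasion.IsWellPosed.{u} (Persuasion.effortSet γ aLo aHi)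
        (Persuasion.agentUtility κ δ γ) (Persuasion.principalUtility κ δ ρ) p ∧
      ((γ < 1 ∧ (1 - γ) * (1 - κ * (1 - γ)) ≤ 1 - ρ) ∨ (1 < γ ∧ γ ≤ ρ) →
        Persuasion.FullDisclosureOptimal.{u} (Persuasion.effortSet γ aLo aHi)
          (Persuasion.agentUtility κ δ γ) (Persuasion.principalUtility κ δ ρ) p) ∧
      ((ρ < 1 ∧ 1 < γ) ∨ (γ < 1 ∧ 1 < ρ) →
        (∃ ω₁ ∈ p.support, ∃ ω₂ ∈ p.support, ω₁ ≠ ω₂) →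
        Persuasion.FullDisclosureSuboptimal.{u} (Persuasion.effortSet γ aLo aHi)
          (Persuasion.agentUtility κ δ γ) (Persuasion.principalUtility κ δ ρ) p) := by
  have H := Persuasion.isMeanPersuasion_principalAgent (ρ := ρ) hκ hθ hδ₀ hδ₁ hγ₁ hΩ hΩ' hA hint
  refine ⟨H.isWellPosed hp, fun h => H.fullDisclosureOptimal hp fun μ _ hμ => ?_, ?_⟩
  · rcases h with ⟨hγ, hρ⟩ | ⟨hγ, hρ⟩
    · exact Persuasion.senderValue_le_disclosedValue_of_lt_one hκ hθ hδ₀ hδ₁ hγ hρ hΩ hμ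
    · exact Persuasion.senderValue_le_disclosedValue_of_one_lt hκ hδ₀ hδ₁ hγ hρ hΩ hμ
  · rintro h ⟨ω₁, h₁, ω₂, h₂, hne⟩
    exact H.fullDisclosureSuboptimal hp <| Persuasion.disclosedValue_lt_senderValue hκ hθ hδ₀ hδ₁ h
      hΩ hp (Persuasion.not_ae_eq_const_of_mem_support h₁ h₂ hne)

theorem mainTheorem5 (κ δ γ ρ : ℝ) (hκ₀ : 0 < κ) (hκ₁ : κ < 1) (hδ₀ : 0 < δ) (hδ₁ : δ < 1)
    (hγ₀ : 0 ≤ γ) (hγ₁ : γ ≠ 1) (hρ₀ : 0 ≤ ρ) (hρ₁ : ρ ≠ 1)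
    (ωLo ωHi : ℝ) (hΩ : 0 < ωLo) (hΩ' : ωLo ≤ ωHi)
    (aLo aHi : ℝ) (hA : 0 ≤ aLo) (hA' : aLo ≤ aHi)
    (hint : ∀ ω ∈ Set.Icc ωLo ωHi, ∃ a ∈ Set.Icc aLo aHi,
      0 < a ∧ HasDerivAt (Persuasion.agentUtility κ δ γ ω) 0 a)
    (p : MeasureTheory.Measure ℝ) [MeasureTheory.IsProbabilityMeasure p]
    (hp : ∀ᵐ ω ∂p, ω ∈ Set.Icc ωLo ωHi) :
    Persuasion.IsWellPosed.{u} (Persuasion.effortSet γ aLo aHi)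
        (Persuasion.agentUtility κ δ γ) (Persuasion.principalUtility κ δ ρ) p ∧
      ((ρ ≤ γ ∧ γ < 1) ∨ (γ ≤ ρ ∧ 1 < γ) →
        Persuasion.FullDisclosureOptimal.{u} (Persuasion.effortSet γ aLo aHi)
          (Persuasion.agentUtility κ δ γ) (Persuasion.principalUtility κ δ ρ) p) ∧
      ((ρ < 1 ∧ 1 < γ) ∨ (γ < 1 ∧ 1 < ρ) →
        (∃ ω₁ ∈ p.support, ∃ ω₂ ∈ p.support, ω₁ ≠ ω₂) →
        Persuasion.FullDisclosureSuboptimal.{u} (Persuasion.effortSet γ aLo aHi)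
          (Persuasion.agentUtility κ δ γ) (Persuasion.principalUtility κ δ ρ) p) := by
  obtain ⟨hwell, hopt, hsub⟩ := mainTheorem5_general (ρ := ρ) hκ₀ (by nlinarith) hδ₀ hδ₁ hγ₁ hρ₁
    hΩ hΩ' hA hint hp
  refine ⟨hwell, fun h => hopt (h.imp (fun h => ⟨h.2, ?_⟩) And.symm), hsub⟩
  nlinarith [mul_nonneg hκ₀.le (sq_nonneg (1 - γ))]
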